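/- Let $\lambda$ be an infinite regular cardinal, and for an ordinal or cardinal $\mu$ let $[\mu]^2$ denote the set of pairs $(\alpha,\beta)$ with $\alpha<\beta<\mu$. Then there exist two maps $c:[\lambda^+]^2\to\lambda^+\times\lambda^+$ and $e:[\lambda^+]^2\to\lambda$ such that: 1. $e$ is subadditive, i.e., for all $\alpha<\beta<\gamma<\lambda^+$, $$e(\alpha,\gamma)\le\max\{e(\alpha,\beta),e(\beta,\gamma)\}\quad\text{and}\quad e(\alpha,\beta)\le\max\{e(\alpha,\gamma),e(\beta,\gamma)\};$$ 2. for every $A\subseteq\lambda^+$ with $|A|=\lambda^+$, there exists a club (closed and unbounded set) $D\subseteq\lambda^+$ such that for every $\delta\in D$, every $\beta$ with $\delta\le\beta<\lambda^+$, every $(\xi_0,\xi_1)\in\delta\times\delta$ and every $i<\lambda$, there are cofinally many $\alpha<\delta$ (that is, for every $\eta<\delta$ there is such an $\alpha$ with $\eta<\alpha<\delta$) satisfying $\alpha\in A$, $c(\alpha,\beta)=(\xi_0,\xi_1)$ and $e(\alpha,\beta)>i$. -/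

import Mathlib

universe u

open Cardinal Order

/-- `[α]²` for a linear order `α`: an unordered pair of distinct elements is given by its
increasing enumeration. -/
abbrev IncPair (α : Type*) [LinearOrder α] : Type _ :=
  {p : α × α // p.1 < p.2}

/-- Subadditivity of a coloring `e : [α]² → θ`. -/
def IsSubadditiveColoring {α θ : Type*} [LinearOrder α] [LinearOrder θ]
    (e : IncPair α → θ) : Prop :=
  ∀ (a b c : α) (hab : a < b) (hbc : b < c),
    e ⟨(a, c), hab.trans hbc⟩ ≤ max (e ⟨(a, b), hab⟩) (e ⟨(b, c), hbc⟩) ∧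
    e ⟨(a, b), hab⟩ ≤ max (e ⟨(a, c), hab.trans hbc⟩) (e ⟨(b, c), hbc⟩)

/-- The initial ordinal of a cardinal `κ`, as a well-ordered type of order type `κ.ord`; its
elements stand for the ordinals below `κ`. -/
abbrev CardOrd (κ : Cardinal.{u}) : Type u :=
  κ.ord.ToType

set_option linter.unusedSectionVars false

/-! Take Todorcevic's ρ for e. It is subadditive, and each β has fewer than λ points x < β with
ρ(x,β) ≤ v. Hence if δ is good (a successor, or of cofinality λ) and α, β ≥ δ, then ρ(·,α) and
ρ(·,β) agree on a final segment of δ.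

The color c(α,β) is read off the walk from β to α+1: stop after k steps and apply a map h to the
point reached, where all classes of h are stationary. A pressing-down argument fixes one k that
leads to unboundedly many points of a given class, so it remains to make the pair (α,β) encode k.
Here k is the 2-adic valuation of osc(α,β), the number of changes from ρ(x,α) ≤ ρ(x,β) to ρ(x,α) >
ρ(x,β) as x increases through the lower trace. Good closure points, in the role of elementary
submodels, allow a lower trace to be end-extended by a block of equality and then a block of strict
inequality, which adds exactly one rise (`Reflects.exists_extension_rise`). So a single α realizes
arbitrarily long intervals of oscillation values (`exists_osc_eq`), and these contain numbers of any
prescribed valuation.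

This yields `exists_coloring`. Arguing by contradiction gives a threshold past which every β works;
splitting A into λ pieces and using local smallness of ρ makes e large; the closure points of the
thresholds form D. -/

namespace RectangleColoring

/-! ### Regularity, good points and unbounded sets -/

section Basics

variable {lam : Cardinal.{u}} [hlam : Fact lam.IsRegular]

theorem aleph0_le : ℵ₀ ≤ lam := hlam.out.aleph0_le

instance : NoMaxOrder (CardOrd lam) := Cardinal.noMaxOrder aleph0_le

instance : Fact (succ lam).IsRegular := ⟨isRegular_succ aleph0_le⟩

instance : Nonempty (CardOrd lam) := by
  rw [Ordinal.nonempty_toType_iff, ne_eq, Cardinal.ord_eq_zero]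
  exact hlam.out.ne_zero

/-- A set of size less than `κ` is strictly bounded in a regular cardinal `κ`. -/
theorem exists_gt_of_mk_lt {X : Set (CardOrd lam)} (h : #X < lam) : ∃ u, ∀ x ∈ X, x < u := by
  by_contra! hX
  have h1 : IsCofinal X := fun a ↦ by
    obtain ⟨x, hx, hax⟩ := hX a
    exact ⟨x, hx, hax⟩
  have h2 := cof_le h1
  rw [Ordinal.cof_toType, hlam.out.cof_ord] at h2
  exact h2.not_gt h

theorem exists_gt_of_mk_le {X : Set (CardOrd (succ lam))} (h : #X ≤ lam) : ∃ u, ∀ x ∈ X, x < u :=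
  exists_gt_of_mk_lt (lt_succ_of_le h)

theorem mk_Iio_lt (i : CardOrd lam) : #(Set.Iio i) < lam := by
  simpa using Cardinal.mk_Iio_lt i (by simp)

theorem mk_Iic_lt (i : CardOrd lam) : #(Set.Iic i) < lam := by
  obtain ⟨j, hj⟩ := exists_gt i
  exact (mk_le_mk_of_subset fun x hx ↦ lt_of_le_of_lt hx hj).trans_lt (mk_Iio_lt j)

theorem mk_Iic_le (x : CardOrd (succ lam)) : #(Set.Iic x) ≤ lam :=
  le_of_lt_succ (mk_Iic_lt x)

theorem mk_Iio_le (x : CardOrd (succ lam)) : #(Set.Iio x) ≤ lam :=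
  le_of_lt_succ (mk_Iio_lt x)

/-- Families indexed by a set of size at most `κ` are bounded in `κ⁺`. -/
theorem exists_forall_lt {ι : Type u} (h : #ι ≤ lam) (f : ι → CardOrd (succ lam)) :
    ∃ u, ∀ i, f i < u := by
  obtain ⟨u, hu⟩ := exists_gt_of_mk_le (X := Set.range f) (mk_range_le.trans h)
  exact ⟨u, fun i ↦ hu _ ⟨i, rfl⟩⟩

theorem mk_cardOrd : #(CardOrd lam) = lam := mk_ord_toType lam

/-- `δ` is inaccessible by fewer than `κ` smaller elements. -/
def IsGood (δ : CardOrd (succ lam)) : Prop :=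
  ∀ X : Set (CardOrd (succ lam)), #X < lam → (∀ x ∈ X, x < δ) → ∃ η < δ, ∀ x ∈ X, x ≤ η

theorem isGood_succ (α : CardOrd (succ lam)) : IsGood (Order.succ α) :=
  fun _ _ h ↦ ⟨α, lt_succ α, fun x hx ↦ le_of_lt_succ (h x hx)⟩

theorem IsGood.exists_lt {δ : CardOrd (succ lam)} (h : IsGood δ) : ∃ η, η < δ := by
  obtain ⟨η, h1, -⟩ := h ∅ (by simpa using hlam.out.pos) (by simp)
  exact ⟨η, h1⟩

theorem IsGood.finset {δ : CardOrd (succ lam)} (h : IsGood δ) (F : Finset (CardOrd (succ lam)))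
    (hF : ∀ x ∈ F, x < δ) : ∃ η < δ, ∀ x ∈ F, x ≤ η :=
  h F ((mk_coe_finset.trans_lt (natCast_lt_aleph0)).trans_le aleph0_le) hF

/-- Unboundedness, in strict form. -/
def Unbdd (U : Set (CardOrd (succ lam))) : Prop := ∀ x, ∃ a ∈ U, x < a

theorem unbdd_univ : Unbdd (lam := lam) Set.univ := fun x ↦
  ⟨succ x, trivial, lt_succ x⟩

theorem not_unbdd {U : Set (CardOrd (succ lam))} (h : ¬ Unbdd U) : ∃ x, ∀ a ∈ U, a ≤ x := by
  simpa [Unbdd] using h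

theorem unbdd_of_mk {U : Set (CardOrd (succ lam))} (h : #U = succ lam) : Unbdd U := by
  by_contra hU
  obtain ⟨x, hx⟩ := not_unbdd hU
  have h1 : #U ≤ #(Set.Iic x) := mk_le_mk_of_subset hx
  exact (h1.trans (mk_Iic_le x)).not_gt ((lt_succ lam).trans_eq h.symm)

theorem Unbdd.pigeonhole {ι : Type u} (hι : #ι ≤ lam) {U : Set (CardOrd (succ lam))}
    (hU : Unbdd U) (f : CardOrd (succ lam) → ι) : ∃ i, Unbdd {x ∈ U | f x = i} := by
  by_contra! h
  choose b hb using fun i ↦ not_unbdd (h i)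
  obtain ⟨u, hu⟩ := exists_forall_lt hι b
  obtain ⟨a, ha, hua⟩ := hU u
  exact ((hb (f a) a ⟨ha, rfl⟩).trans_lt (hu _)).not_gt hua

/-- Sequences of length `κ` in an unbounded set which grow faster than a given function. -/
theorem Unbdd.exists_seq {U : Set (CardOrd (succ lam))} (hU : Unbdd U)
    (H : CardOrd (succ lam) → CardOrd (succ lam)) :
    ∃ v : CardOrd lam → CardOrd (succ lam), (∀ i, v i ∈ U) ∧ ∀ j i, j < i → H (v j) < v i := by
  have key : ∀ (i : CardOrd lam) (w : Set.Iio i → CardOrd (succ lam)),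
      ∃ a ∈ U, ∀ j, H (w j) < a := fun i w ↦ by
    obtain ⟨x, hx⟩ := exists_forall_lt (mk_Iio_lt i).le fun j ↦ H (w j)
    obtain ⟨a, ha, hxa⟩ := hU x
    exact ⟨a, ha, fun j ↦ (hx j).trans hxa⟩
  choose F hF1 hF2 using key
  let v : CardOrd lam → CardOrd (succ lam) :=
    (wellFounded_lt (α := CardOrd lam)).fix fun i w ↦ F i fun j ↦ w j.1 j.2
  have hv : ∀ i, v i = F i fun j ↦ v j.1 := fun i ↦ WellFounded.fix_eq _ _ _
  refine ⟨v, fun i ↦ hv i ▸ hF1 _ _, fun j i hji ↦ ?_⟩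
  rw [hv i]
  exact hF2 i (fun j ↦ v j.1) ⟨j, hji⟩

/-- There are good points closed under any given function. -/
theorem exists_isGood_closed (G : CardOrd (succ lam) → CardOrd (succ lam))
    (x₀ : CardOrd (succ lam)) : ∃ δ, x₀ < δ ∧ IsGood δ ∧ ∀ γ < δ, G γ < δ := by
  have hH : ∀ x, ∃ y, x < y ∧ ∀ γ ≤ x, G γ < y := fun x ↦ by
    obtain ⟨u, hu⟩ := exists_forall_lt (mk_Iic_le x) fun γ ↦ G γ.1
    exact ⟨max u (succ x), lt_max_of_lt_right (lt_succ x),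
      fun γ hγ ↦ lt_max_of_lt_left (hu ⟨γ, hγ⟩)⟩
  choose H hH1 hH2 using hH
  have hU : Unbdd (Set.Ioi x₀) := fun x ↦
    ⟨succ (max x x₀), Set.mem_Ioi.2 (lt_succ_of_le (le_max_right _ _)),
      lt_succ_of_le (le_max_left _ _)⟩
  obtain ⟨v, hv1, hv2⟩ := hU.exists_seq H
  obtain ⟨u, hu⟩ := exists_forall_lt (mk_cardOrd (lam := lam)).le v
  -- The supremum of an increasing λ-sequence has cofinality λ, hence is good.
  let S : Set (CardOrd (succ lam)) := {y | ∀ i, v i < y}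
  let δ := wellFounded_lt.min S ⟨u, hu⟩
  have hδ : ∀ i, v i < δ := WellFounded.min_mem wellFounded_lt S ⟨u, hu⟩
  have hδ' : ∀ γ < δ, ∃ i, γ ≤ v i := fun γ hγ ↦ by
    by_contra! hc
    exact WellFounded.not_lt_min wellFounded_lt S hc hγ
  refine ⟨δ, (hv1 (Classical.arbitrary _)).trans (hδ _), fun X hX hXδ ↦ ?_, fun γ hγ ↦ ?_⟩
  · choose! f hf using hδ'
    obtain ⟨i, hi⟩ := exists_gt_of_mk_lt (X := f '' X) (mk_image_le.trans_lt hX)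
    refine ⟨v i, hδ i, fun x hx ↦ (hf x (hXδ x hx)).trans ?_⟩
    exact ((hH1 _).trans (hv2 _ _ (hi _ ⟨x, hx, rfl⟩))).le
  · obtain ⟨i, hi⟩ := hδ' γ hγ
    obtain ⟨j, hj⟩ := exists_gt i
    exact ((hH2 _ _ hi).trans (hv2 _ _ hj)).trans (hδ j)

/-- Functions on a `κ⁺`-filtered family of sets of size at most `κ` have majorants. -/
theorem exists_majorant {P : Type u} (Q : CardOrd (succ lam) → Set P) (hQ : ∀ γ, #(Q γ) ≤ lam)
    (G : P → CardOrd (succ lam)) :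
    ∃ G' : CardOrd (succ lam) → CardOrd (succ lam), ∀ γ, ∀ p ∈ Q γ, G p < G' γ := by
  choose G' hG' using fun γ ↦ exists_forall_lt (hQ γ) fun p ↦ G p.1
  exact ⟨G', fun γ p hp ↦ hG' γ ⟨p, hp⟩⟩

end Basics

/-! ### Enumerations of predecessors and one step of a walk -/

section Ladder

variable {lam : Cardinal.{u}} [hlam : Fact lam.IsRegular]

theorem exists_enumeration (β : CardOrd (succ lam)) : ∃ g : CardOrd lam → CardOrd (succ lam),
    ∀ α < β, (∀ i, g i < β) ∧ ∃ i, g i = α := by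
  by_cases h : ∃ α, α < β
  · have h1 : #(Set.Iio β) ≤ #(CardOrd lam) := (mk_Iio_le β).trans mk_cardOrd.ge
    obtain ⟨α, hα⟩ := h
    have : Nonempty (Set.Iio β) := ⟨⟨α, hα⟩⟩
    obtain ⟨e⟩ := h1
    refine ⟨fun i ↦ (Function.invFun e i).1, fun α hα ↦ ⟨fun i ↦ (Function.invFun e i).2,
      e ⟨α, hα⟩, ?_⟩⟩
    exact congrArg Subtype.val (Function.leftInverse_invFun e.injective ⟨α, hα⟩)
  · exact ⟨fun _ ↦ β, fun α hα ↦ (h ⟨α, hα⟩).elim⟩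

/-- An enumeration of the predecessors of `β` in type `κ`. -/
noncomputable def enumBelow (β : CardOrd (succ lam)) : CardOrd lam → CardOrd (succ lam) :=
  (exists_enumeration β).choose

theorem enumBelow_lt {α β : CardOrd (succ lam)} (h : α < β) (i : CardOrd lam) :
    enumBelow β i < β :=
  ((exists_enumeration β).choose_spec α h).1 i

theorem exists_enumBelow_eq {α β : CardOrd (succ lam)} (h : α < β) : ∃ i, enumBelow β i = α :=
  ((exists_enumeration β).choose_spec α h).2

theorem exists_firstIndex (α β : CardOrd (succ lam)) : ∃ i : CardOrd lam,
    α < β → α ≤ enumBelow β i ∧ ∀ j < i, enumBelow β j < α := by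
  by_cases h : α < β
  · obtain ⟨i, hi⟩ := exists_enumBelow_eq h
    obtain ⟨m, hm, hm'⟩ := wellFounded_lt.has_min {i | α ≤ enumBelow β i} ⟨i, hi.ge⟩
    exact ⟨m, fun _ ↦ ⟨hm, fun j hj ↦ not_le.1 fun hc ↦ hm' j hc hj⟩⟩
  · exact ⟨Classical.arbitrary _, fun h' ↦ (h h').elim⟩

/-- The first index at which the enumeration of the predecessors of `β` reaches `α`. -/
noncomputable def firstIndex (α β : CardOrd (succ lam)) : CardOrd lam :=
  (exists_firstIndex α β).choose

/-- The first element of the enumeration of the predecessors of `β` which is at least `α`: one step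
of the walk from `β` to `α`. -/
noncomputable def step (α β : CardOrd (succ lam)) : CardOrd (succ lam) :=
  enumBelow β (firstIndex α β)

variable {α β γ δ : CardOrd (succ lam)}

theorem le_step (h : α < β) : α ≤ step α β := ((exists_firstIndex α β).choose_spec h).1

theorem step_lt (h : α < β) : step α β < β := enumBelow_lt h _

theorem enumBelow_lt_of_lt_firstIndex (h : α < β) {j : CardOrd lam} (hj : j < firstIndex α β) :
    enumBelow β j < α :=
  ((exists_firstIndex α β).choose_spec h).2 j hj

theorem firstIndex_le (h : α < β) {j : CardOrd lam} (hj : α ≤ enumBelow β j) :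
    firstIndex α β ≤ j :=
  not_lt.1 fun hc ↦ (enumBelow_lt_of_lt_firstIndex h hc).not_ge hj

theorem firstIndex_mono (hab : α ≤ β) (h : β < γ) : firstIndex α γ ≤ firstIndex β γ :=
  firstIndex_le (hab.trans_lt h) (hab.trans (le_step h))

theorem firstIndex_eq_of_le_step (hab : α ≤ β) (h : β < γ) (hs : β ≤ step α γ) :
    firstIndex α γ = firstIndex β γ :=
  (firstIndex_mono hab h).antisymm (firstIndex_le h hs)

theorem step_eq_of_le_step (hab : α ≤ β) (h : β < γ) (hs : β ≤ step α γ) :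
    step α γ = step β γ := by
  rw [step, step, firstIndex_eq_of_le_step hab h hs]

/-- This puts `step α γ` among the points enumerated before β is reached, where the last clause in
the definition of `rho` controls it. -/
theorem firstIndex_lt_of_step_lt (hab : α ≤ β) (h : β < γ) (hs : step α γ < β) :
    firstIndex α γ < firstIndex β γ := by
  refine (firstIndex_mono hab h).lt_of_ne fun hc ↦ hs.not_ge ?_
  rw [step, hc]
  exact le_step h

end Ladder

/-! ### Least elements -/

section Least

variable {κ : Cardinal.{u}} [hκ : Fact κ.IsRegular]

open Classical in
/-- The least element of a set of ordinals below `κ`, if there is one. -/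
noncomputable def least (s : Set (CardOrd κ)) : CardOrd κ :=
  if h : s.Nonempty then wellFounded_lt.min s h else Classical.arbitrary _

theorem least_mem {s : Set (CardOrd κ)} (h : s.Nonempty) : least s ∈ s := by
  rw [least, dif_pos h]
  exact WellFounded.min_mem _ _ _

theorem least_le {s : Set (CardOrd κ)} {x : CardOrd κ} (h : x ∈ s) : least s ≤ x := by
  rw [least, dif_pos ⟨x, h⟩]
  exact not_lt.1 (WellFounded.not_lt_min _ _ h)

end Least

/-! ### The subadditive function ρ -/

section Rho

variable {lam : Cardinal.{u}} [hlam : Fact lam.IsRegular]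

open Classical in
/-- Todorcevic's function `ρ : [κ⁺]² → κ`. -/
noncomputable def rho (α β : CardOrd (succ lam)) : CardOrd lam :=
  if _h : α < β then
    least {v | firstIndex α β ≤ v ∧ rho α (step α β) ≤ v ∧
      ∀ i < firstIndex α β, rho (enumBelow β i) α ≤ v}
  else least Set.univ
termination_by β
decreasing_by
  · exact step_lt _h
  · exact _h

variable {α β γ δ : CardOrd (succ lam)}

theorem rho_le_iff (h : α < β) {v : CardOrd lam} : rho α β ≤ v ↔
    firstIndex α β ≤ v ∧ rho α (step α β) ≤ v ∧
      ∀ i < firstIndex α β, rho (enumBelow β i) α ≤ v := by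
  have hne : {v | firstIndex α β ≤ v ∧ rho α (step α β) ≤ v ∧
      ∀ i < firstIndex α β, rho (enumBelow β i) α ≤ v}.Nonempty := by
    obtain ⟨u, hu⟩ := exists_gt_of_mk_lt
      (X := (fun i ↦ rho (enumBelow β i) α) '' Set.Iio (firstIndex α β))
      (mk_image_le.trans_lt (mk_Iio_lt _))
    exact ⟨max u (max (firstIndex α β) (rho α (step α β))), by simp, by simp,
      fun i hi ↦ le_max_of_le_left (hu _ ⟨i, hi, rfl⟩).le⟩
  have h1 := least_mem hne
  rw [rho, dif_pos h]
  refine ⟨fun hv ↦ ⟨h1.1.trans hv, h1.2.1.trans hv, fun i hi ↦ (h1.2.2 i hi).trans hv⟩,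
    fun hv ↦ least_le hv⟩

/-- The default value is 0, so subadditivity survives when arguments coincide, as happens when a
walk lands on its target. -/
theorem rho_of_not_lt (h : ¬ α < β) (v : CardOrd lam) : rho α β ≤ v := by
  rw [rho, dif_neg h]
  exact least_le trivial

/-- Both inequalities are proved together by induction on γ. If the step from γ towards α stays at
or above β, it is also the step towards β; otherwise it lands in [α, β), and ρ(β,γ) bounds its
ρ-distance to β. -/
theorem rho_subadditive (γ : CardOrd (succ lam)) : ∀ α β, α ≤ β → β ≤ γ →
    rho α γ ≤ max (rho α β) (rho β γ) ∧ rho α β ≤ max (rho α γ) (rho β γ) := by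
  induction γ using WellFoundedLT.induction with
  | ind γ ih =>
  intro α β hab hbc
  rcases hbc.eq_or_lt with rfl | hbc
  · simp
  rcases hab.eq_or_lt with rfl | hab
  · simp [rho_of_not_lt (lt_irrefl α)]
  have hac := hab.trans hbc
  obtain ⟨a1, a2, a3⟩ := (rho_le_iff hac).1 le_rfl
  obtain ⟨b1, b2, b3⟩ := (rho_le_iff hbc).1 le_rfl
  constructor
  · rw [rho_le_iff hac]
    refine ⟨le_max_of_le_right ((firstIndex_mono hab.le hbc).trans b1), ?_, fun i hi ↦ ?_⟩
    · rcases le_or_gt β (step α γ) with hs | hs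
      · have := step_eq_of_le_step hab.le hbc hs
        refine (ih _ (step_lt hac) α β hab.le hs).1.trans (max_le_max le_rfl ?_)
        rwa [this]
      · refine (ih β hbc α _ (le_step hac) hs.le).2.trans (max_le_max le_rfl ?_)
        exact b3 _ (firstIndex_lt_of_step_lt hab.le hbc hs)
    · have h1 := enumBelow_lt_of_lt_firstIndex hac hi
      refine (ih β hbc _ α h1.le hab.le).2.trans
        (max_le (le_max_of_le_right ?_) (le_max_left _ _))
      exact b3 i (hi.trans_le (firstIndex_mono hab.le hbc))
  · rcases le_or_gt β (step α γ) with hs | hs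
    · have := step_eq_of_le_step hab.le hbc hs
      refine (ih _ (step_lt hac) α β hab.le hs).2.trans (max_le_max a2 ?_)
      rwa [this]
    · refine (ih β hbc α _ (le_step hac) hs.le).1.trans (max_le_max a2 ?_)
      exact b3 _ (firstIndex_lt_of_step_lt hab.le hbc hs)

theorem mk_biUnion_lt {ι : Type u} {α : Type u} {s : Set ι} (hs : #s < lam) {t : ι → Set α}
    (ht : ∀ i ∈ s, #(t i) < lam) : #(⋃ i ∈ s, t i : Set α) < lam :=
  (card_biUnion_lt_iff_forall_of_isRegular (t := fun i _ ↦ t i) hlam.out hs).2 ht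

/-- `ρ` is locally small. -/
theorem mk_rho_le_lt (β : CardOrd (succ lam)) (v : CardOrd lam) :
    #{x | x < β ∧ rho x β ≤ v} < lam := by
  induction β using WellFoundedLT.induction with
  | ind β ih =>
  by_cases hβ : ∃ α, α < β
  swap
  · push Not at hβ
    have : {x | x < β ∧ rho x β ≤ v} = ∅ := by
      ext x
      simpa using fun hx ↦ ((hβ x).not_gt hx).elim
    rw [this]
    simpa using hlam.out.pos
  obtain ⟨α, hα⟩ := hβ
  -- A value at most v bounds the first index by v, so x equals, or has ρ at most v to, one of fewer
  -- than λ points.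
  have hsub : {x | x < β ∧ rho x β ≤ v} ⊆
      ⋃ i ∈ Set.Iic v, insert (enumBelow β i)
        {x | x < enumBelow β i ∧ rho x (enumBelow β i) ≤ v} := by
    rintro x ⟨hx, hxv⟩
    obtain ⟨h1, h2, -⟩ := (rho_le_iff hx).1 hxv
    simp only [Set.mem_iUnion]
    refine ⟨firstIndex x β, h1, ?_⟩
    rcases (le_step hx).eq_or_lt with h | h
    · exact Or.inl h
    · exact Or.inr ⟨h, h2⟩
  refine (mk_le_mk_of_subset hsub).trans_lt (mk_biUnion_lt (mk_Iic_lt v) fun i _ ↦ ?_)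
  refine (mk_insert_le).trans_lt ?_
  exact add_lt_of_lt aleph0_le (ih _ (enumBelow_lt hα i)) (one_lt_aleph0.trans_le aleph0_le)

/-- `ρ(·, α)` and `ρ(·, β)` agree below `δ ≤ α, β` except on a small set. -/
theorem mk_rho_ne_lt (δ α β : CardOrd (succ lam)) (hα : δ ≤ α) (hβ : δ ≤ β) :
    #{x | x < δ ∧ rho x α ≠ rho x β} < lam := by
  wlog hab : α ≤ β generalizing α β
  · simpa only [ne_comm] using this β α hβ hα (le_of_not_ge hab)
  -- Once ρ(x,α) exceeds ρ(α,β), the two subadditivity inequalities force ρ(x,α) = ρ(x,β).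
  refine (mk_le_mk_of_subset ?_).trans_lt (mk_rho_le_lt α (rho α β))
  rintro x ⟨hx, hne⟩
  have hxa := hx.trans_le hα
  obtain ⟨h1, h2⟩ := rho_subadditive β x α hxa.le hab
  refine ⟨hxa, ?_⟩
  by_contra! hc
  refine hne (le_antisymm ?_ ?_)
  · rcases le_max_iff.1 h2 with h | h
    · exact h
    · exact (hc.not_ge h).elim
  · rcases le_max_iff.1 h1 with h | h
    · exact h
    · exact h.trans hc.le

end Rho

/-! ### Walks and lower traces -/

section Walk

variable {lam : Cardinal.{u}} [hlam : Fact lam.IsRegular]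

/-- The supremum of the elements below `α` which are enumerated before the first one which is at
least `α`. -/
noncomputable def supBelow (α β : CardOrd (succ lam)) : CardOrd (succ lam) :=
  least {y | ∀ i < firstIndex α β, enumBelow β i ≤ y}

variable {α β γ δ : CardOrd (succ lam)}

theorem enumBelow_le_supBelow (h : α < β) {i : CardOrd lam} (hi : i < firstIndex α β) :
    enumBelow β i ≤ supBelow α β :=
  least_mem (s := {y | ∀ i < firstIndex α β, enumBelow β i ≤ y})
    ⟨α, fun _ hj ↦ (enumBelow_lt_of_lt_firstIndex h hj).le⟩ i hi

theorem supBelow_lt (hα : IsGood α) (h : α < β) : supBelow α β < α := by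
  obtain ⟨η, h1, h2⟩ := hα (enumBelow β '' Set.Iio (firstIndex α β))
    (mk_image_le.trans_lt (mk_Iio_lt _)) (by
      rintro _ ⟨i, hi, rfl⟩
      exact enumBelow_lt_of_lt_firstIndex h hi)
  exact (least_le (s := {y | ∀ i < firstIndex α β, enumBelow β i ≤ y})
    fun i hi ↦ h2 _ ⟨i, hi, rfl⟩).trans_lt h1

/-- Nothing enumerated before δ is reached lies at or above α, so walks to α and to δ start with the
same step. -/
theorem firstIndex_eq_of_supBelow_lt (hδ : δ < β) (hαδ : α ≤ δ) (h : supBelow δ β < α) :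
    firstIndex α β = firstIndex δ β := by
  refine (firstIndex_mono hαδ hδ).antisymm (not_lt.1 fun hc ↦ ?_)
  exact ((le_step (hαδ.trans_lt hδ)).trans (enumBelow_le_supBelow hδ hc)).not_gt h

/-- The increasing records of the suprema along the walk from `β` to `α`: the lower trace. -/
noncomputable def lowerTrace (α β : CardOrd (succ lam)) : Finset (CardOrd (succ lam)) :=
  if _h : α < β then
    insert (supBelow α β) ((lowerTrace α (step α β)).filter (supBelow α β < ·))
  else ∅
termination_by β
decreasing_by exact step_lt _h

theorem lowerTrace_of_lt (h : α < β) : lowerTrace α β =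
    insert (supBelow α β) ((lowerTrace α (step α β)).filter (supBelow α β < ·)) := by
  rw [lowerTrace, dif_pos h]

theorem lowerTrace_self : lowerTrace α α = ∅ := by
  rw [lowerTrace, dif_neg (lt_irrefl α)]

theorem supBelow_mem (h : α < β) : supBelow α β ∈ lowerTrace α β := by
  rw [lowerTrace_of_lt h]
  exact Finset.mem_insert_self _ _

theorem lt_of_mem_lowerTrace (hα : IsGood α) {x : CardOrd (succ lam)}
    (hx : x ∈ lowerTrace α β) : x < α := by
  induction β using WellFoundedLT.induction with
  | ind β ih =>
  by_cases h : α < β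
  · rw [lowerTrace_of_lt h, Finset.mem_insert, Finset.mem_filter] at hx
    rcases hx with rfl | hx
    · exact supBelow_lt hα h
    · exact ih _ (step_lt h) hx.1
  · rw [lowerTrace, dif_neg h] at hx
    simp at hx

theorem supBelow_le_of_mem (h : α < β) {x : CardOrd (succ lam)} (hx : x ∈ lowerTrace α β) :
    supBelow α β ≤ x := by
  rw [lowerTrace_of_lt h, Finset.mem_insert, Finset.mem_filter] at hx
  rcases hx with rfl | hx
  · exact le_rfl
  · exact hx.2.le

/-- Concatenation of lower traces. -/
theorem lowerTrace_eq_union (hα : IsGood α) (hαδ : α < δ) (hδβ : δ ≤ β)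
    (h : ∀ x ∈ lowerTrace δ β, ∀ y ∈ lowerTrace α δ, x < y) :
    lowerTrace α β = lowerTrace δ β ∪ lowerTrace α δ := by
  induction β using WellFoundedLT.induction with
  | ind β ih =>
  rcases hδβ.eq_or_lt with rfl | hδβ
  · simp [lowerTrace_self]
  have hαβ := hαδ.trans hδβ
  have h1 : ∀ y ∈ lowerTrace α δ, supBelow δ β < y := h _ (supBelow_mem hδβ)
  have h2 : supBelow δ β < α := (h1 _ (supBelow_mem hαδ)).trans (supBelow_lt hα hαδ)
  have h3 := firstIndex_eq_of_supBelow_lt hδβ hαδ.le h2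
  have h4 : step α β = step δ β := by rw [step, step, h3]
  have h5 : supBelow α β = supBelow δ β := by rw [supBelow, supBelow, h3]
  have h6 := ih (step δ β) (step_lt hδβ) (le_step hδβ) fun x hx y hy ↦ by
    rcases le_or_gt x (supBelow δ β) with hc | hc
    · exact hc.trans_lt (h1 y hy)
    · refine h x ?_ y hy
      rw [lowerTrace_of_lt hδβ, Finset.mem_insert, Finset.mem_filter]
      exact Or.inr ⟨hx, hc⟩
  rw [lowerTrace_of_lt hαβ, lowerTrace_of_lt hδβ, h4, h5, h6, Finset.filter_union,
    Finset.insert_union]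
  congr 2
  exact Finset.filter_true_of_mem h1

/-- Lower traces from a good point `δ` converge to `δ`. -/
theorem IsGood.exists_lowerTrace_gt (hδ : IsGood δ) (hlim : ∀ x < δ, succ x < δ) (hγ : γ < δ) :
    ∃ ν < δ, ∀ ξ, ν < ξ → ξ < δ → ∀ x ∈ lowerTrace ξ δ, γ < x := by
  -- If ξ exceeds everything enumerated up to index i, then `succ γ` is enumerated before ξ is
  -- reached and lies below the least element of the trace.
  obtain ⟨i, hi⟩ := exists_enumBelow_eq (hlim γ hγ)
  obtain ⟨ν, hν, h⟩ := hδ (enumBelow δ '' Set.Iic i) (mk_image_le.trans_lt (mk_Iic_lt i)) (by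
    rintro _ ⟨j, -, rfl⟩
    exact enumBelow_lt hγ j)
  refine ⟨ν, hν, fun ξ h1 h2 x hx ↦ ?_⟩
  have h3 : i < firstIndex ξ δ := by
    by_contra! hc
    exact ((le_step h2).trans (h _ ⟨_, hc, rfl⟩)).not_gt h1
  calc γ < succ γ := lt_succ γ
    _ = enumBelow δ i := hi.symm
    _ ≤ supBelow ξ δ := enumBelow_le_supBelow h2 h3
    _ ≤ x := supBelow_le_of_mem h2 hx

/-- The point reached after `k` steps of the walk from `β` to `α`. -/
noncomputable def walk (α : CardOrd (succ lam)) : ℕ → CardOrd (succ lam) → CardOrd (succ lam)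
  | 0, β => β
  | k + 1, β => walk α k (step α β)

/-- Walks to points just below a good point `δ` pass through `δ`. -/
theorem IsGood.exists_walk_eq (hδ : IsGood δ) (h : δ ≤ β) :
    ∃ k, ∃ η < δ, ∀ α, η < α → α ≤ δ → walk α k β = δ := by
  induction β using WellFoundedLT.induction with
  | ind β ih =>
  rcases h.eq_or_lt with rfl | h
  · obtain ⟨η, hη⟩ := hδ.exists_lt
    exact ⟨0, η, hη, fun _ _ _ ↦ rfl⟩
  obtain ⟨k, η, hη, hk⟩ := ih _ (step_lt h) (le_step h)
  refine ⟨k + 1, max η (supBelow δ β), max_lt hη (supBelow_lt hδ h), fun α h1 h2 ↦ ?_⟩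
  have h3 : step α β = step δ β := by
    rw [step, step, firstIndex_eq_of_supBelow_lt h h2 ((le_max_right _ _).trans_lt h1)]
  rw [walk, h3]
  exact hk α ((le_max_left _ _).trans_lt h1) h2

end Walk

/-! ### Counting rises along a finite set -/

section Rises

variable {α : Type*} [LinearOrder α] {s t : α → Prop} {L M : Finset α}

/-- The element `x` of `L` satisfies `s` and its predecessor in `L` does not. -/
def IsRise (s : α → Prop) (L : Finset α) (x : α) : Prop :=
  s x ∧ ∃ y ∈ L, y < x ∧ ¬ s y ∧ ∀ z ∈ L, z < x → z ≤ y

open Classical in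
/-- The number of times that `s` changes from false to true along `L`. -/
noncomputable def rises (s : α → Prop) (L : Finset α) : ℕ := (L.filter (IsRise s L)).card

theorem rises_congr (h : ∀ x ∈ L, s x ↔ t x) : rises s L = rises t L := by
  classical
  refine congrArg Finset.card (Finset.filter_congr fun x hx ↦ ?_)
  unfold IsRise
  rw [h x hx]
  refine and_congr_right fun _ ↦ exists_congr fun y ↦ and_congr_right fun hy ↦ ?_
  rw [h y hy]

open Classical in
theorem rises_union (h : ∀ x ∈ L, ∀ y ∈ M, x < y) :
    rises s (L ∪ M) = rises s L + (M.filter (IsRise s (L ∪ M))).card := by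
  have hd : Disjoint L M := Finset.disjoint_left.2 fun x hx hy ↦ (h x hx x hy).false
  unfold rises
  rw [Finset.filter_union, Finset.card_union_of_disjoint (Finset.disjoint_filter_filter hd)]
  congr 2
  refine Finset.filter_congr fun x hx ↦ and_congr_right fun _ ↦ ⟨?_, ?_⟩
  · rintro ⟨y, hy, hyx, hsy, hz⟩
    rcases Finset.mem_union.1 hy with hy | hy
    · exact ⟨y, hy, hyx, hsy, fun z hz' ↦ hz z (Finset.mem_union_left _ hz')⟩
    · exact ((h x hx y hy).not_gt hyx).elim
  · rintro ⟨y, hy, hyx, hsy, hz⟩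
    refine ⟨y, Finset.mem_union_left _ hy, hyx, hsy, fun z hz' hzx ↦ ?_⟩
    rcases Finset.mem_union.1 hz' with hz' | hz'
    · exact hz z hz' hzx
    · exact ((h x hx z hz').not_gt hzx).elim

theorem rises_union_of_forall_not (h : ∀ x ∈ L, ∀ y ∈ M, x < y) (hM : ∀ y ∈ M, ¬ s y) :
    rises s (L ∪ M) = rises s L := by
  classical
  rw [rises_union h, Finset.filter_false_of_mem fun y hy hr ↦ hM y hy hr.1]
  simp

/-- The only new rise is at the minimum of M, whose predecessor is the last element of L. -/
theorem rises_union_of_forall (h : ∀ x ∈ L, ∀ y ∈ M, x < y) (hM : ∀ y ∈ M, s y)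
    (hne : M.Nonempty) (hL : ∃ x ∈ L, ¬ s x ∧ ∀ z ∈ L, z ≤ x) :
    rises s (L ∪ M) = rises s L + 1 := by
  classical
  rw [rises_union h, Finset.card_eq_one.2 ⟨M.min' hne, ?_⟩]
  obtain ⟨x, hx, hsx, hmax⟩ := hL
  ext y
  rw [Finset.mem_filter, Finset.mem_singleton]
  constructor
  · rintro ⟨hy, -, w, hw, hwy, hsw, hz⟩
    refine le_antisymm ?_ (Finset.min'_le _ _ hy)
    by_contra! hc
    have h1 := hz _ (Finset.mem_union_right _ (Finset.min'_mem M hne)) hc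
    rcases Finset.mem_union.1 hw with hw | hw
    · exact (h w hw _ (Finset.min'_mem M hne)).not_ge h1
    · exact hsw (hM w hw)
  · rintro rfl
    have hm := Finset.min'_mem M hne
    refine ⟨hm, hM _ hm, x, Finset.mem_union_left _ hx, h x hx _ hm, hsx, fun z hz hzm ↦ ?_⟩
    rcases Finset.mem_union.1 hz with hz | hz
    · exact hmax z hz
    · exact ((Finset.min'_le _ _ hz).not_gt hzm).elim

/-- Since s holds at the end of L, the junction creates no rise. -/
theorem rises_union_of_last (h : ∀ x ∈ L, ∀ y ∈ M, x < y)
    (hL : ∃ x ∈ L, s x ∧ ∀ z ∈ L, z ≤ x) :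
    rises s (L ∪ M) = rises s L + rises s M := by
  classical
  rw [rises_union h, rises]
  obtain ⟨x, hx, hsx, hmax⟩ := hL
  congr 2
  refine Finset.filter_congr fun y hy ↦ and_congr_right fun _ ↦ ⟨?_, ?_⟩
  · rintro ⟨w, hw, hwy, hsw, hz⟩
    rcases Finset.mem_union.1 hw with hw | hw
    · have := le_antisymm (hz x (Finset.mem_union_left _ hx) (h x hx y hy)) (hmax w hw)
      exact (hsw (this ▸ hsx)).elim
    · exact ⟨w, hw, hwy, hsw, fun z hz' ↦ hz z (Finset.mem_union_right _ hz')⟩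
  · rintro ⟨w, hw, hwy, hsw, hz⟩
    refine ⟨w, Finset.mem_union_right _ hw, hwy, hsw, fun z hz' hzy ↦ ?_⟩
    rcases Finset.mem_union.1 hz' with hz' | hz'
    · exact (h z hz' w hw).le
    · exact hz z hz' hzy

end Rises

/-! ### Making ρ large on finite sets, and counting data -/

section Reflection

variable {lam : Cardinal.{u}} [hlam : Fact lam.IsRegular]

/-- Otherwise every γ has a bad finite set above it. Fix the bound v by pigeonhole and choose λ many
bad sets, one above the other. A single α in U past all of them has a point with ρ ≤ v in each,
against local smallness. -/
theorem Unbdd.exists_rho_gt {U : Set (CardOrd (succ lam))} (hU : Unbdd U) :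
    ∃ γ, ∀ F : Finset (CardOrd (succ lam)), (∀ y ∈ F, γ < y) → ∀ (v : CardOrd lam)
      (x : CardOrd (succ lam)), ∃ α ∈ U, x < α ∧ ∀ y ∈ F, v < rho y α := by
  by_contra! hc
  choose F hF v x hv using hc
  obtain ⟨v₀, hv₀⟩ := (unbdd_univ (lam := lam)).pigeonhole mk_cardOrd.le v
  have hH : ∀ γ, ∃ z, ∀ y ∈ F γ, y < z := fun γ ↦ by
    obtain ⟨z, hz⟩ := exists_gt_of_mk_lt (X := (F γ : Set (CardOrd (succ lam))))
      (((F γ).finite_toSet.lt_aleph0).trans_le (aleph0_le (lam := succ lam)))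
    exact ⟨z, hz⟩
  choose H hH using hH
  obtain ⟨w, hw1, hw2⟩ := hv₀.exists_seq H
  obtain ⟨u, hu⟩ := exists_forall_lt (mk_cardOrd (lam := lam)).le fun i ↦ max (x (w i)) (H (w i))
  obtain ⟨α, hα, huα⟩ := hU u
  choose y hy1 hy2 using fun i ↦ hv (w i) α hα
    (((le_max_left _ _).trans_lt (hu i)).trans huα)
  have hmono : StrictMono y := fun j i hji ↦
    ((hH _ _ (hy1 j)).trans (hw2 j i hji)).trans (hF _ _ (hy1 i))
  have hsub : Set.range y ⊆ {x | x < α ∧ rho x α ≤ v₀} := by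
    rintro _ ⟨i, rfl⟩
    refine ⟨((hH _ _ (hy1 i)).trans_le (le_max_right _ _)).trans ((hu i).trans huα), ?_⟩
    exact (hy2 i).trans_eq (hw1 i).2
  have h1 := (mk_le_mk_of_subset hsub).trans_lt (mk_rho_le_lt α v₀)
  rw [mk_range_eq _ hmono.injective, mk_cardOrd] at h1
  exact h1.false

/-- Finite pieces of data on a point of a rectangle: the values of two functions on a finite set,
together with two ordinals. -/
abbrev Data (lam : Cardinal.{u}) : Type u :=
  Finset (CardOrd (succ lam) × CardOrd lam × CardOrd lam) ×
    CardOrd (succ lam) × CardOrd (succ lam)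

/-- The data consisting of ordinals up to `γ`. -/
def dataBelow (γ : CardOrd (succ lam)) : Set (Data lam) :=
  {p | (∀ t ∈ p.1, t.1 ≤ γ) ∧ p.2.1 ≤ γ ∧ p.2.2 ≤ γ}

theorem mk_dataBelow_le (γ : CardOrd (succ lam)) : #(dataBelow γ) ≤ lam := by
  classical
  let T := Finset (Set.Iic γ × CardOrd lam × CardOrd lam) × Set.Iic γ × Set.Iic γ
  let f : T → Data lam := fun p ↦
    (p.1.image fun t ↦ ((t.1 : CardOrd (succ lam)), t.2), p.2.1, p.2.2)
  have hsub : dataBelow γ ⊆ Set.range f := by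
    rintro ⟨F, x, y⟩ ⟨h1, h2, h3⟩
    refine ⟨(F.attach.image fun t ↦ (⟨t.1.1, h1 _ t.2⟩, t.1.2), ⟨x, h2⟩, ⟨y, h3⟩), ?_⟩
    simp only [f, Prod.mk.injEq, and_true]
    ext t
    simp only [Finset.mem_image, Finset.mem_attach, true_and, Subtype.exists]
    constructor
    · rintro ⟨_, ⟨t, ht, rfl⟩, rfl⟩
      exact ht
    · exact fun ht ↦ ⟨_, ⟨t, ht, rfl⟩, rfl⟩
  refine ((mk_le_mk_of_subset hsub).trans mk_range_le).trans ?_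
  have h0 := aleph0_le (lam := lam)
  have h1 : #(Set.Iic γ × CardOrd lam × CardOrd lam) ≤ lam := by
    simp only [mk_prod, lift_id, mk_cardOrd]
    exact mul_le_of_le h0 (mk_Iic_le γ) (mul_le_of_le h0 le_rfl le_rfl)
  have h2 : #(Finset (Set.Iic γ × CardOrd lam × CardOrd lam)) ≤ lam := by
    refine (mk_le_of_surjective List.toFinset_surjective).trans ((mk_list_le_max _).trans ?_)
    exact max_le h0 h1
  simp only [T, mk_prod, lift_id]
  exact mul_le_of_le h0 h2 (mul_le_of_le h0 (mk_Iic_le γ) (mk_Iic_le γ))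

end Reflection

/-! ### Reflecting points and oscillation along lower traces -/

section Oscillation

variable {lam : Cardinal.{u}} [hlam : Fact lam.IsRegular]

/-- The graph of the pair `ρ(·, α)`, `ρ(·, β)` on a finite set. -/
noncomputable def rhoGraph (α β : CardOrd (succ lam)) (L : Finset (CardOrd (succ lam))) :
    Finset (CardOrd (succ lam) × CardOrd lam × CardOrd lam) :=
  L.image fun x ↦ (x, rho x α, rho x β)

theorem rhoGraph_eq {α β α' β' : CardOrd (succ lam)} {L L' : Finset (CardOrd (succ lam))}
    (h : rhoGraph α β L = rhoGraph α' β' L') :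
    L = L' ∧ ∀ x ∈ L, rho x α' = rho x α ∧ rho x β' = rho x β := by
  have h1 : L = L' := by
    have := congrArg (Finset.image Prod.fst) h
    simpa [rhoGraph, Finset.image_image, Function.comp_def] using this
  refine ⟨h1, fun x hx ↦ ?_⟩
  have h2 : (x, rho x α, rho x β) ∈ rhoGraph α' β' L' :=
    h ▸ Finset.mem_image_of_mem (fun x ↦ (x, rho x α, rho x β)) hx
  obtain ⟨y, -, hy⟩ := Finset.mem_image.1 h2
  simp only [Prod.mk.injEq] at hy
  obtain ⟨rfl, h3, h4⟩ := hy
  exact ⟨h3, h4⟩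

/-- The good points which realize the given data inside the rectangle. -/
def realizers (A : Set (CardOrd (succ lam))) (b : CardOrd (succ lam) → CardOrd (succ lam))
    (p : Data lam) : Set (CardOrd (succ lam)) :=
  {δ | IsGood δ ∧ ∃ α ∈ A, ∃ s, δ ≤ α ∧ δ ≤ s ∧ rhoGraph α (b s) (lowerTrace δ (b s)) = p.1 ∧
    (∀ x, p.2.1 ≤ x → x < δ → rho x α = rho x (b s)) ∧
    ∀ ξ, p.2.2 < ξ → ξ < δ → ∀ x ∈ lowerTrace ξ δ, p.2.1 < x}

/-- The elements of `A` which realize the first coordinate of the data. -/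
def agreeing (A : Set (CardOrd (succ lam))) (p : Data lam) : Set (CardOrd (succ lam)) :=
  {α ∈ A | ∀ t ∈ p.1, rho t.1 α = t.2.1}

/-- `δ` behaves like the trace on `κ⁺` of an elementary submodel containing `A` and `b`. -/
structure Reflects (A : Set (CardOrd (succ lam)))
    (b : CardOrd (succ lam) → CardOrd (succ lam)) (δ : CardOrd (succ lam)) : Prop where
  good : IsGood δ
  succ_lt : ∀ x < δ, succ x < δ
  unbdd_realizers : ∀ γ < δ, ∀ p ∈ dataBelow γ, δ ∈ realizers A b p → Unbdd (realizers A b p)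
  unbdd_agreeing : ∀ γ < δ, ∀ p ∈ dataBelow γ, ∀ α ∈ agreeing A p, δ ≤ α → Unbdd (agreeing A p)
  exists_rho_gt : ∀ γ < δ, ∀ p ∈ dataBelow γ, Unbdd (agreeing A p) → ∃ η < δ,
    ∀ F : Finset (CardOrd (succ lam)), (∀ y ∈ F, η < y) → ∀ (v : CardOrd lam)
      (x : CardOrd (succ lam)), ∃ α ∈ agreeing A p, x < α ∧ ∀ y ∈ F, v < rho y α
  exists_lt : ∀ γ < δ, ∀ p ∈ dataBelow γ, Unbdd (agreeing A p) →
    ∃ α ∈ agreeing A p, p.2.2 < α ∧ α < δ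

/-- Each requirement has a witness or bound depending on the data alone. Only λ many data lie below
each γ, so a good closure point of a majorant suffices. -/
theorem exists_reflects (A : Set (CardOrd (succ lam)))
    (b : CardOrd (succ lam) → CardOrd (succ lam)) : ∃ δ, Reflects A b δ := by
  have e1 : ∀ p, ∃ g, ¬ Unbdd (realizers A b p) → ∀ a ∈ realizers A b p, a ≤ g := fun p ↦ by
    by_cases h : Unbdd (realizers A b p)
    · exact ⟨Classical.arbitrary _, fun h' ↦ (h' h).elim⟩
    · exact (not_unbdd h).imp fun _ hx _ ↦ hx
  have e2 : ∀ p, ∃ g, ¬ Unbdd (agreeing A p) → ∀ a ∈ agreeing A p, a ≤ g := fun p ↦ by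
    by_cases h : Unbdd (agreeing A p)
    · exact ⟨Classical.arbitrary _, fun h' ↦ (h' h).elim⟩
    · exact (not_unbdd h).imp fun _ hx _ ↦ hx
  have e3 : ∀ p, ∃ g, Unbdd (agreeing A p) →
      ∀ F : Finset (CardOrd (succ lam)), (∀ y ∈ F, g < y) → ∀ (v : CardOrd lam)
        (x : CardOrd (succ lam)), ∃ α ∈ agreeing A p, x < α ∧ ∀ y ∈ F, v < rho y α := fun p ↦ by
    by_cases h : Unbdd (agreeing A p)
    · exact h.exists_rho_gt.imp fun _ hx _ ↦ hx
    · exact ⟨Classical.arbitrary _, fun h' ↦ (h h').elim⟩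
  have e4 : ∀ p, ∃ g, Unbdd (agreeing A p) → g ∈ agreeing A p ∧ p.2.2 < g := fun p ↦ by
    by_cases h : Unbdd (agreeing A p)
    · exact (h p.2.2).imp fun _ hx _ ↦ hx
    · exact ⟨Classical.arbitrary _, fun h' ↦ (h h').elim⟩
  choose g1 hg1 using e1
  choose g2 hg2 using e2
  choose g3 hg3 using e3
  choose g4 hg4 using e4
  obtain ⟨G, hG⟩ := exists_majorant dataBelow mk_dataBelow_le
    fun p ↦ max (max (g1 p) (g2 p)) (max (g3 p) (g4 p))
  obtain ⟨δ, -, hδ, hcl⟩ := exists_isGood_closed (fun γ ↦ max (G γ) (succ γ))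
    (Classical.arbitrary _)
  have hcl' : ∀ γ < δ, ∀ p ∈ dataBelow γ, (g1 p < δ ∧ g2 p < δ) ∧ g3 p < δ ∧ g4 p < δ := by
    intro γ hγ p hp
    have := (hG γ p hp).trans ((le_max_left _ _).trans_lt (hcl γ hγ))
    simpa only [max_lt_iff] using this
  refine ⟨δ, hδ, fun x hx ↦ (le_max_right _ _).trans_lt (hcl x hx), ?_, ?_, ?_, ?_⟩
  · intro γ hγ p hp hmem
    by_contra hc
    exact (hg1 p hc δ hmem).not_gt (hcl' γ hγ p hp).1.1
  · intro γ hγ p hp α hα hδα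
    by_contra hc
    exact (hδα.trans (hg2 p hc α hα)).not_gt (hcl' γ hγ p hp).1.2
  · exact fun γ hγ p hp hu ↦ ⟨g3 p, (hcl' γ hγ p hp).2.1, hg3 p hu⟩
  · exact fun γ hγ p hp hu ↦ ⟨g4 p, (hg4 p hu).1, (hg4 p hu).2, (hcl' γ hγ p hp).2.2⟩

variable {A : Set (CardOrd (succ lam))} {b : CardOrd (succ lam) → CardOrd (succ lam)}
  {δ α s γ : CardOrd (succ lam)}

theorem IsGood.exists_rho_eq (hδ : IsGood δ) {α β : CardOrd (succ lam)} (hα : δ ≤ α)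
    (hβ : δ ≤ β) : ∃ η < δ, ∀ x, η < x → x < δ → rho x α = rho x β := by
  obtain ⟨η, h1, h2⟩ := hδ _ (mk_rho_ne_lt δ α β hα hβ) fun x hx ↦ hx.1
  refine ⟨η, h1, fun x h3 h4 ↦ ?_⟩
  by_contra hc
  exact (h2 x ⟨h4, hc⟩).not_gt h3

/-- The data of a point of the rectangle lie below `δ`. -/
theorem Reflects.exists_dataBelow (h : Reflects A b δ) {γ ν : CardOrd (succ lam)} (hγ : γ < δ)
    (hν : ν < δ) (α β : CardOrd (succ lam)) : ∃ η < δ,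
    ((rhoGraph α β (lowerTrace δ β), γ, ν) : Data lam) ∈ dataBelow η := by
  obtain ⟨η, h1, h2⟩ := h.good.finset _ fun x hx ↦ lt_of_mem_lowerTrace (β := β) h.good hx
  refine ⟨max η (max γ ν), max_lt h1 (max_lt hγ hν), fun t ht ↦ ?_, by simp, by simp⟩
  obtain ⟨x, hx, rfl⟩ := Finset.mem_image.1 ht
  exact le_max_of_le_left (h2 x hx)

theorem mem_agreeing (hα : α ∈ A) (β γ ν : CardOrd (succ lam))
    (L : Finset (CardOrd (succ lam))) :
    α ∈ agreeing A ((rhoGraph α β L, γ, ν) : Data lam) := by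
  refine ⟨hα, fun t ht ↦ ?_⟩
  obtain ⟨x, hx, rfl⟩ := Finset.mem_image.1 ht
  rfl

theorem rho_eq_of_mem_agreeing {α α' β γ ν x : CardOrd (succ lam)}
    {L : Finset (CardOrd (succ lam))}
    (h : α' ∈ agreeing A ((rhoGraph α β L, γ, ν) : Data lam)) (hx : x ∈ L) :
    rho x α' = rho x α :=
  h.2 (x, rho x α, rho x β) (Finset.mem_image_of_mem _ hx)

/-- The lower trace can be end-extended by a set on which the two functions agree. -/
theorem Reflects.exists_extension_eq (h : Reflects A b δ) (hb : ∀ s, s ≤ b s) (hα : α ∈ A)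
    (hδα : δ ≤ α) (hδs : δ ≤ s) (hγ : γ < δ) :
    ∃ α' ∈ A, ∃ s', δ ≤ α' ∧ δ ≤ s' ∧ ∃ M : Finset (CardOrd (succ lam)), M.Nonempty ∧
      lowerTrace δ (b s') = lowerTrace δ (b s) ∪ M ∧
      (∀ x ∈ lowerTrace δ (b s), ∀ y ∈ M, x < y) ∧
      (∀ x ∈ lowerTrace δ (b s), rho x α' = rho x α ∧ rho x (b s') = rho x (b s)) ∧
      ∀ y ∈ M, γ < y ∧ rho y α' = rho y (b s') := by
  obtain ⟨η₁, hη₁, hη₁'⟩ := h.good.exists_rho_eq hδα (hδs.trans (hb s))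
  obtain ⟨η₂, hη₂, hη₂'⟩ := h.good.finset _ fun x hx ↦
    lt_of_mem_lowerTrace (β := b s) h.good hx
  -- From γ₀ on the two functions agree below δ, and no element of the old trace exceeds γ₀.
  obtain ⟨γ₀, hγ₀, hγγ₀, hη₁γ₀, hη₂γ₀⟩ : ∃ γ₀ < δ, γ ≤ γ₀ ∧ η₁ < γ₀ ∧ η₂ ≤ γ₀ :=
    ⟨max γ (max (succ η₁) η₂), max_lt hγ (max_lt (h.succ_lt _ hη₁) hη₂), le_max_left _ _,
      (lt_succ η₁).trans_le (by simp), by simp⟩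
  obtain ⟨ν, hν, hν'⟩ := h.good.exists_lowerTrace_gt h.succ_lt hγ₀
  obtain ⟨η, hη, hp⟩ := h.exists_dataBelow hγ₀ hν α (b s)
  have hmem : δ ∈ realizers A b (rhoGraph α (b s) (lowerTrace δ (b s)), γ₀, ν) :=
    ⟨h.good, α, hα, s, hδα, hδs, rfl, fun x h1 h2 ↦ hη₁' x (hη₁γ₀.trans_le h1) h2, hν'⟩
  -- As δ realizes its own data, some δ' > δ realizes them too. The new block is the trace from δ'
  -- to δ: it lies above γ₀ and below δ', where the new pair of functions agrees.
  obtain ⟨δ', ⟨hδ', α', hα', s', h1, h2, h3, h4, h5⟩, hδδ'⟩ :=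
    h.unbdd_realizers η hη _ hp hmem δ
  obtain ⟨h6, h7⟩ := rhoGraph_eq h3
  have h8 : ∀ y ∈ lowerTrace δ δ', γ₀ < y := h5 δ hν hδδ'
  have h9 : ∀ x ∈ lowerTrace δ' (b s'), ∀ y ∈ lowerTrace δ δ', x < y := fun x hx y hy ↦
    ((hη₂' x (h6 ▸ hx)).trans hη₂γ₀).trans_lt (h8 y hy)
  refine ⟨α', hα', s', hδδ'.le.trans h1, hδδ'.le.trans h2, lowerTrace δ δ',
    ⟨_, supBelow_mem hδδ'⟩, ?_, h6 ▸ h9, fun x hx ↦ ?_, fun y hy ↦ ⟨hγγ₀.trans_lt (h8 y hy), ?_⟩⟩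
  · rw [lowerTrace_eq_union h.good hδδ' (h2.trans (hb s')) h9, h6]
  · obtain ⟨h10, h11⟩ := h7 x (h6 ▸ hx)
    exact ⟨h10.symm, h11.symm⟩
  · exact h4 y (h8 y hy).le ((lt_of_mem_lowerTrace h.good hy).trans hδδ')

/-- The lower trace can be end-extended by a set on which the first function is larger. -/
theorem Reflects.exists_extension_lt (h : Reflects A b δ) (hb : ∀ s, s ≤ b s) (hα : α ∈ A)
    (hδα : δ ≤ α) (hδs : δ ≤ s) :
    ∃ α' ∈ A, ∃ s', δ ≤ α' ∧ δ ≤ s' ∧ ∃ M : Finset (CardOrd (succ lam)), M.Nonempty ∧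
      lowerTrace δ (b s') = lowerTrace δ (b s) ∪ M ∧
      (∀ x ∈ lowerTrace δ (b s), ∀ y ∈ M, x < y) ∧
      (∀ x ∈ lowerTrace δ (b s), rho x α' = rho x α ∧ rho x (b s') = rho x (b s)) ∧
      ∀ y ∈ M, rho y (b s') < rho y α' := by
  obtain ⟨ζ, hζ⟩ := h.good.exists_lt
  obtain ⟨η, hη, hp⟩ := h.exists_dataBelow hζ hζ α (b s)
  have hmem := mem_agreeing hα (b s) ζ ζ (lowerTrace δ (b s))
  obtain ⟨γ, hγ, hγ'⟩ := h.exists_rho_gt η hη _ hp (h.unbdd_agreeing η hη _ hp α hmem hδα)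
  obtain ⟨α₁, hα₁, s', h1, h2, M, hM, h3, h4, h5, h6⟩ := h.exists_extension_eq hb hα hδα hδs hγ
  -- The block M lies above γ, so α₁ can be replaced by an α' with the same values on the old trace
  -- and larger values on M.
  obtain ⟨α', hα', h7, h8⟩ := hγ' M (fun y hy ↦ (h6 y hy).1)
    (M.sup' hM fun y ↦ rho y (b s')) δ
  refine ⟨α', hα'.1, s', h7.le, h2, M, hM, h3, h4,
    fun x hx ↦ ⟨rho_eq_of_mem_agreeing hα' hx, (h5 x hx).2⟩, fun y hy ↦ ?_⟩
  exact (Finset.le_sup' (fun y ↦ rho y (b s')) hy).trans_lt (h8 y hy)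

/-- The sign at `x` of the comparison of `ρ(·, α)` and `ρ(·, β)`. -/
def rhoSign (α β x : CardOrd (succ lam)) : Prop := rho x β < rho x α

/-- A predicate holds at the last element of a finite set. -/
def HoldsAtLast (t : CardOrd (succ lam) → Prop) (L : Finset (CardOrd (succ lam))) : Prop :=
  ∃ x ∈ L, t x ∧ ∀ z ∈ L, z ≤ x

theorem holdsAtLast_union {t : CardOrd (succ lam) → Prop} {L M : Finset (CardOrd (succ lam))}
    (h : ∀ x ∈ L, ∀ y ∈ M, x < y) (hM : M.Nonempty) (ht : ∀ y ∈ M, t y) :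
    HoldsAtLast t (L ∪ M) := by
  have hm := Finset.max'_mem M hM
  refine ⟨M.max' hM, Finset.mem_union_right _ hm, ht _ hm, fun z hz ↦ ?_⟩
  rcases Finset.mem_union.1 hz with hz | hz
  · exact (h z hz _ hm).le
  · exact Finset.le_max' _ _ hz

theorem HoldsAtLast.congr {t t' : CardOrd (succ lam) → Prop} {L : Finset (CardOrd (succ lam))}
    (h : HoldsAtLast t L) (htt' : ∀ x ∈ L, t x ↔ t' x) : HoldsAtLast t' L := by
  obtain ⟨x, hx, h1, h2⟩ := h
  exact ⟨x, hx, (htt' x hx).1 h1, h2⟩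

/-- Append a block of equality, then one where the first function is larger. Whatever the sign at
the end of the old trace, this adds exactly one rise and ends with the sign true. -/
theorem Reflects.exists_extension_rise (h : Reflects A b δ) (hb : ∀ s, s ≤ b s) (hα : α ∈ A)
    (hδα : δ ≤ α) (hδs : δ ≤ s) :
    ∃ α' ∈ A, ∃ s', δ ≤ α' ∧ δ ≤ s' ∧ lowerTrace δ (b s) ⊆ lowerTrace δ (b s') ∧
      (∀ x ∈ lowerTrace δ (b s), rho x α' = rho x α) ∧
      HoldsAtLast (rhoSign α' (b s')) (lowerTrace δ (b s')) ∧
      rises (rhoSign α' (b s')) (lowerTrace δ (b s')) =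
        rises (rhoSign α (b s)) (lowerTrace δ (b s)) + 1 := by
  obtain ⟨ζ, hζ⟩ := h.good.exists_lt
  obtain ⟨α₁, hα₁, s₁, h1, h2, M, hM, h3, h4, h5, h6⟩ := h.exists_extension_eq hb hα hδα hδs hζ
  obtain ⟨α₂, hα₂, s₂, k1, k2, N, hN, k3, k4, k5, k6⟩ := h.exists_extension_lt hb hα₁ h1 h2
  have k7 : ∀ y ∈ M, ¬ rhoSign α₂ (b s₂) y := fun y hy ↦ by
    obtain ⟨h7, h8⟩ := k5 y (h3 ▸ Finset.mem_union_right _ hy)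
    rw [rhoSign, h7, h8, (h6 y hy).2]
    exact lt_irrefl _
  have k8 : ∀ x ∈ lowerTrace δ (b s), rho x α₂ = rho x α ∧ rho x (b s₂) = rho x (b s) :=
    fun x hx ↦ by
      obtain ⟨h7, h8⟩ := k5 x (h3 ▸ Finset.mem_union_left _ hx)
      rw [h7, h8]
      exact h5 x hx
  refine ⟨α₂, hα₂, s₂, k1, k2, ?_, fun x hx ↦ (k8 x hx).1, ?_, ?_⟩
  · rw [k3, h3]
    exact Finset.subset_union_left.trans Finset.subset_union_left
  · rw [k3]
    exact holdsAtLast_union k4 hN k6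
  · rw [k3, rises_union_of_forall (s := rhoSign α₂ (b s₂)) k4 k6 hN, h3,
      rises_union_of_forall_not h4 k7, rises_congr (t := rhoSign α (b s)) fun x hx ↦ ?_]
    · rw [rhoSign, rhoSign, (k8 x hx).1, (k8 x hx).2]
    · rw [h3]
      exact holdsAtLast_union (t := fun x ↦ ¬ rhoSign α₂ (b s₂) x) h4 hM k7

/-- Later extensions change α but keep its values on the current trace. Nestedness of the traces
therefore preserves all earlier signs and rise counts. -/
theorem Reflects.exists_rises (h : Reflects A b δ) (hb : ∀ s, s ≤ b s) (hA : Unbdd A) (n : ℕ) :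
    ∃ α ∈ A, δ ≤ α ∧ ∃ (σ : ℕ → CardOrd (succ lam)) (m : ℕ), ∀ i ≤ n, δ ≤ σ i ∧
      HoldsAtLast (rhoSign α (b (σ i))) (lowerTrace δ (b (σ i))) ∧
      rises (rhoSign α (b (σ i))) (lowerTrace δ (b (σ i))) = m + i ∧
      lowerTrace δ (b (σ i)) ⊆ lowerTrace δ (b (σ n)) := by
  induction n with
  | zero =>
    obtain ⟨α, hα, hδα⟩ := hA δ
    obtain ⟨α', hα', s', h1, h2, -, -, h3, -⟩ := h.exists_extension_rise hb hα hδα.le le_rfl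
    refine ⟨α', hα', h1, fun _ ↦ s', rises (rhoSign α' (b s')) (lowerTrace δ (b s')),
      fun i hi ↦ ⟨h2, h3, ?_, subset_rfl⟩⟩
    rw [Nat.le_zero.1 hi, add_zero]
  | succ n ih =>
    obtain ⟨α, hα, hδα, σ, m, hσ⟩ := ih
    obtain ⟨α', hα', s', h1, h2, h3, h4, h5, h6⟩ :=
      h.exists_extension_rise hb hα hδα (hσ n le_rfl).1
    refine ⟨α', hα', h1, fun i ↦ if i ≤ n then σ i else s', m, fun i hi ↦ ?_⟩
    have hn : ¬ n + 1 ≤ n := by omega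
    rcases Nat.le_succ_iff.1 hi with hi | rfl
    · obtain ⟨k1, k2, k3, k4⟩ := hσ i hi
      have k5 : ∀ x ∈ lowerTrace δ (b (σ i)),
          rhoSign α (b (σ i)) x ↔ rhoSign α' (b (σ i)) x := fun x hx ↦ by
        rw [rhoSign, rhoSign, h4 x (k4 hx)]
      simp only [if_pos hi, if_neg hn]
      exact ⟨k1, k2.congr k5, rises_congr k5 ▸ k3, k4.trans h3⟩
    · simp only [if_neg hn]
      refine ⟨h2, h5, ?_, subset_rfl⟩
      rw [h6, (hσ n le_rfl).2.2.1, add_assoc]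

/-- The oscillation of `ρ(·, α)` and `ρ(·, β)` along the lower trace. -/
noncomputable def osc (α β : CardOrd (succ lam)) : ℕ :=
  -- The target is α+1 because successors are always good, while α need not be; goodness keeps the
  -- trace below the target.
  rises (rhoSign α β) (lowerTrace (succ α) β)

/-- On rectangles, the oscillation takes all values in arbitrarily long intervals. -/
theorem exists_osc_eq (hb : ∀ s, s ≤ b s) (hA : Unbdd A) (n : ℕ) :
    ∃ α ∈ A, ∃ (σ : ℕ → CardOrd (succ lam)) (m : ℕ), ∀ i ≤ n,
      α < σ i ∧ osc α (b (σ i)) = m + i := by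
  obtain ⟨δ, h⟩ := exists_reflects A b
  obtain ⟨α, hα, hδα, σ, m, hσ⟩ := h.exists_rises hb hA n
  have hσb : ∀ i ≤ n, δ ≤ b (σ i) := fun i hi ↦ (hσ i hi).1.trans (hb _)
  have e1 : ∀ i, ∃ η < δ, i ≤ n → ∀ x, η < x → x < δ → rho x (b (σ i)) = rho x (b (σ 0)) := by
    intro i
    by_cases hi : i ≤ n
    · obtain ⟨η, h1, h2⟩ := h.good.exists_rho_eq (hσb i hi) (hσb 0 (Nat.zero_le n))
      exact ⟨η, h1, fun _ ↦ h2⟩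
    · obtain ⟨η, hη⟩ := h.good.exists_lt
      exact ⟨η, hη, fun h' ↦ (hi h').elim⟩
  choose η hη hη' using e1
  -- Above γ₁ all the functions ρ(·, b(σ i)) agree below δ; γ₂ will bound the longest trace, hence
  -- all of them.
  obtain ⟨γ₁, hγ₁, hγ₁'⟩ := h.good.finset ((Finset.range (n + 1)).image η) fun x hx ↦ by
    obtain ⟨i, -, rfl⟩ := Finset.mem_image.1 hx
    exact hη i
  obtain ⟨γ₂, hγ₂, hγ₂'⟩ := h.good.finset _ fun x hx ↦
    lt_of_mem_lowerTrace (β := b (σ n)) h.good hx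
  have hγ₀ := max_lt hγ₁ hγ₂
  obtain ⟨ν, hν, hν'⟩ := h.good.exists_lowerTrace_gt h.succ_lt hγ₀
  obtain ⟨ζ, hζ, hp⟩ := h.exists_dataBelow hγ₀ hν α (b (σ n))
  have hmem := mem_agreeing hα (b (σ n)) (max γ₁ γ₂) ν (lowerTrace δ (b (σ n)))
  obtain ⟨α', hα', h1, h2⟩ := h.exists_lt ζ hζ _ hp (h.unbdd_agreeing ζ hζ _ hp α hmem hδα)
  have h3 := h.succ_lt α' h2
  have h4 : ∀ y ∈ lowerTrace (succ α') δ, max γ₁ γ₂ < y :=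
    hν' (succ α') (h1.trans (lt_succ α')) h3
  -- The trace from δ down to α'+1 lies above γ₁, so its contribution is the same for every i and
  -- may be computed at i = 0.
  refine ⟨α', hα'.1, σ, m + rises (rhoSign α' (b (σ 0))) (lowerTrace (succ α') δ),
    fun i hi ↦ ?_⟩
  obtain ⟨k1, k2, k3, k4⟩ := hσ i hi
  have h5 : ∀ x ∈ lowerTrace δ (b (σ i)), ∀ y ∈ lowerTrace (succ α') δ, x < y := fun x hx y hy ↦
    ((hγ₂' x (k4 hx)).trans (le_max_right _ _)).trans_lt (h4 y hy)
  have h6 : ∀ x ∈ lowerTrace δ (b (σ i)),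
      rhoSign α (b (σ i)) x ↔ rhoSign α' (b (σ i)) x := fun x hx ↦ by
    rw [rhoSign, rhoSign, rho_eq_of_mem_agreeing hα' (k4 hx)]
  refine ⟨h2.trans_le k1, ?_⟩
  rw [osc, lowerTrace_eq_union (isGood_succ α') h3 (hσb i hi) h5,
    rises_union_of_last h5 (k2.congr h6), ← rises_congr h6, k3,
    rises_congr (t := rhoSign α' (b (σ 0))) fun y hy ↦ ?_]
  · omega
  · have h7 := h4 y hy
    rw [rhoSign, rhoSign, hη' i hi y _ ((lt_of_mem_lowerTrace (isGood_succ α') hy).trans h3)]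
    exact (hγ₁' _ (Finset.mem_image_of_mem _ (by simpa using Nat.lt_succ_of_le hi))).trans_lt
      ((le_max_left _ _).trans_lt h7)

end Oscillation

/-! ### The coloring and the club -/

section Coloring

variable {lam : Cardinal.{u}} [hlam : Fact lam.IsRegular]

theorem exists_padicValNat_eq (k m : ℕ) : ∃ i ≤ 2 ^ (k + 2), padicValNat 2 (m + i) = k := by
  have h1 := Nat.div_add_mod m (2 ^ (k + 1))
  have h2 := Nat.mod_lt m (Nat.two_pow_pos (k + 1))
  set q := m / 2 ^ (k + 1)
  have h3 : m ≤ 2 ^ k * (2 * (q + 1) + 1) ∧ 2 ^ k * (2 * (q + 1) + 1) ≤ m + 2 ^ (k + 2) := by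
    rw [pow_succ] at h1 h2
    rw [pow_add]
    have h3 := Nat.zero_le (m % (2 ^ k * 2))
    have h4 := Nat.two_pow_pos k
    constructor <;> linarith
  -- This reaches an odd multiple of 2^k at or above m.
  refine ⟨2 ^ k * (2 * (q + 1) + 1) - m, by omega, ?_⟩
  have : Fact (Nat.Prime 2) := ⟨Nat.prime_two⟩
  rw [Nat.add_sub_cancel' h3.1, padicValNat.mul (by positivity) (by omega),
    padicValNat.prime_pow, padicValNat.eq_zero_of_not_dvd (by omega), add_zero]

theorem exists_padicValNat_osc_eq {A : Set (CardOrd (succ lam))}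
    {b : CardOrd (succ lam) → CardOrd (succ lam)} (hb : ∀ s, s ≤ b s) (hA : Unbdd A) (k : ℕ) :
    ∃ α ∈ A, ∃ s, α < s ∧ padicValNat 2 (osc α (b s)) = k := by
  obtain ⟨α, hα, σ, m, h⟩ := exists_osc_eq hb hA (2 ^ (k + 2))
  obtain ⟨i, hi, hk⟩ := exists_padicValNat_eq k m
  exact ⟨α, hα, σ i, (h i hi).1, (h i hi).2 ▸ hk⟩

/-- The set meets the good closure points of every function. -/
def Stationary (T : Set (CardOrd (succ lam))) : Prop :=
  ∀ G : CardOrd (succ lam) → CardOrd (succ lam), ∃ δ ∈ T, IsGood δ ∧ ∀ γ < δ, G γ < δ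

/-- Every δ > ξ enumerates ξ at one of λ indices, and λ many failures of stationarity can be
diagonalized into a single function. -/
theorem exists_stationary_enumBelow (ξ : CardOrd (succ lam)) :
    ∃ i : CardOrd lam, Stationary {δ | enumBelow δ i = ξ} := by
  by_contra! hc
  unfold Stationary at hc
  push Not at hc
  choose G hG using hc
  choose G' hG' using fun γ ↦ exists_forall_lt (mk_cardOrd (lam := lam)).le fun i ↦ G i γ
  obtain ⟨δ, h1, h2, h3⟩ := exists_isGood_closed G' ξ
  obtain ⟨i, hi⟩ := exists_enumBelow_eq h1
  obtain ⟨γ, hγ, h⟩ := hG i δ hi h2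
  exact h.not_gt ((hG' γ i).trans (h3 γ hγ))

theorem Unbdd.mk_ge {U : Set (CardOrd (succ lam))} (hU : Unbdd U) : succ lam ≤ #U := by
  rw [succ_le_iff]
  by_contra! hc
  obtain ⟨u, hu⟩ := exists_gt_of_mk_le hc
  obtain ⟨a, ha, hua⟩ := hU u
  exact (hu a ha).not_gt hua

/-- A coloring of the points of `κ⁺` by pairs, all of whose color classes are stationary. -/
theorem exists_stationary_partition :
    ∃ h : CardOrd (succ lam) → CardOrd (succ lam) × CardOrd (succ lam),
      ∀ ξ, Stationary {δ | h δ = ξ} := by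
  choose i hi using exists_stationary_enumBelow (lam := lam)
  -- At a common index i₀ the sets for distinct ξ are disjoint, and λ⁺ many ξ share it: enough for
  -- all pairs.
  obtain ⟨i₀, hi₀⟩ := unbdd_univ.pigeonhole mk_cardOrd.le i
  set X := {ξ ∈ Set.univ | i ξ = i₀}
  have h1 : #(CardOrd (succ lam) × CardOrd (succ lam)) ≤ #X := by
    rw [mk_prod, lift_id, mk_ord_toType, mul_eq_self aleph0_le]
    exact hi₀.mk_ge
  obtain ⟨e⟩ := h1
  refine ⟨fun δ ↦ Function.invFun (fun ξ ↦ (e ξ).1) (enumBelow δ i₀), fun ξ G ↦ ?_⟩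
  obtain ⟨δ, h2, h3⟩ := hi (e ξ).1 G
  refine ⟨δ, ?_, h3⟩
  have h4 : i (e ξ).1 = i₀ := (e ξ).2.2
  rw [h4] at h2
  change Function.invFun _ (enumBelow δ i₀) = ξ
  rw [show enumBelow δ i₀ = (e ξ).1 from h2]
  exact Function.leftInverse_invFun (f := fun ξ ↦ (e ξ : CardOrd (succ lam)))
    (Subtype.val_injective.comp e.injective) ξ

theorem Unbdd.inter_Ioi {U : Set (CardOrd (succ lam))} (hU : Unbdd U) (η : CardOrd (succ lam)) :
    Unbdd {a ∈ U | η < a} := fun x ↦ by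
  obtain ⟨a, ha, h⟩ := hU (max η x)
  exact ⟨a, ⟨ha, (le_max_left _ _).trans_lt h⟩, (le_max_right _ _).trans_lt h⟩

/-- Pressing down: each good δ in T has its own k and η < δ. If every such set were bounded, a point
of T closed under the bounds would exceed its own bound. -/
theorem exists_unbdd_walk_eq {T : Set (CardOrd (succ lam))} (hT : Stationary T)
    {b : CardOrd (succ lam) → CardOrd (succ lam)} (hb : ∀ s, s ≤ b s) :
    ∃ k η, Unbdd {δ ∈ T | ∀ α, η < α → α ≤ δ → walk α k (b δ) = δ} := by
  by_contra! hc
  choose B hB using fun k η ↦ not_unbdd (hc k η)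
  choose G hG using fun γ ↦ exists_forall_lt (ι := ULift.{u} ℕ) (lam := lam)
    (by simpa using aleph0_le) fun k ↦ B k.down γ
  obtain ⟨δ, hδT, hδ, hcl⟩ := hT G
  obtain ⟨k, η, hη, hk⟩ := hδ.exists_walk_eq (hb δ)
  exact ((hB k η δ ⟨hδT, hk⟩).trans_lt (hG η ⟨k⟩)).not_gt (hcl η hη)

theorem exists_coloring : ∃ c : CardOrd (succ lam) → CardOrd (succ lam) →
    CardOrd (succ lam) × CardOrd (succ lam), ∀ A, Unbdd A → ∀ b : CardOrd (succ lam) →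
      CardOrd (succ lam), (∀ s, s ≤ b s) → ∀ ξ, ∃ α ∈ A, ∃ s, α < s ∧ c α (b s) = ξ := by
  obtain ⟨h, hh⟩ := exists_stationary_partition (lam := lam)
  refine ⟨fun α β ↦ h (walk (succ α) (padicValNat 2 (osc α β)) β), fun A hA b hb ξ ↦ ?_⟩
  obtain ⟨k, η, hU⟩ := exists_unbdd_walk_eq (hh ξ) hb
  choose n hn hn' using hU
  -- Thinning b to points whose walks meet the class of ξ after exactly k steps leaves only
  -- valuation k to be realized.
  obtain ⟨α, hα, s, hαs, hk⟩ := exists_padicValNat_osc_eq (b := fun s ↦ b (n s))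
    (fun s ↦ (hn' s).le.trans (hb _)) (hA.inter_Ioi η) k
  refine ⟨α, hα.1, n s, hαs.trans (hn' s), ?_⟩
  change h (walk _ (padicValNat 2 (osc α (b (n s)))) _) = ξ
  rw [hk, (hn s).2 _ (hα.2.trans (lt_succ α)) (succ_le_of_lt (hαs.trans (hn' s)))]
  exact (hn s).1

/-- Every set of full size splits into `κ` many sets of full size. -/
theorem exists_split {A : Set (CardOrd (succ lam))} (hA : #A = succ lam) :
    ∃ P : CardOrd lam → Set (CardOrd (succ lam)), (∀ i, P i ⊆ A ∧ Unbdd (P i)) ∧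
      ∀ i j x, x ∈ P i → x ∈ P j → i = j := by
  have h1 : #(CardOrd lam × CardOrd (succ lam)) = #A := by
    rw [mk_prod, lift_id, lift_id, mk_ord_toType, mk_ord_toType, hA,
      mul_eq_right aleph0_le (le_succ lam) hlam.out.ne_zero]
  obtain ⟨e⟩ := Cardinal.eq.1 h1
  refine ⟨fun i ↦ Set.range fun x ↦ (e (i, x) : CardOrd (succ lam)), fun i ↦ ⟨?_, ?_⟩, ?_⟩
  · rintro _ ⟨x, rfl⟩
    exact (e (i, x)).2
  · refine unbdd_of_mk ((mk_range_eq _ fun x y hxy ↦ ?_).trans (mk_ord_toType _))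
    exact congrArg Prod.snd (e.injective (Subtype.val_injective hxy))
  · rintro i j _ ⟨x, rfl⟩ ⟨y, hy⟩
    have := e.injective (Subtype.val_injective hy)
    exact (congrArg Prod.fst this).symm

/-- If no threshold worked, choosing a failing β ≥ d for each d would give a map b contradicting
`hc`. Applied to λ disjoint pieces of A, this yields λ many α for each β, of which fewer than λ have
ρ(α,β) ≤ i. -/
theorem exists_forall_ge_rho_gt {c : CardOrd (succ lam) → CardOrd (succ lam) →
      CardOrd (succ lam) × CardOrd (succ lam)}
    (hc : ∀ A, Unbdd A → ∀ b : CardOrd (succ lam) → CardOrd (succ lam), (∀ s, s ≤ b s) →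
      ∀ ξ, ∃ α ∈ A, ∃ s, α < s ∧ c α (b s) = ξ)
    {A : Set (CardOrd (succ lam))} (hA : #A = succ lam) (η : CardOrd (succ lam))
    (ξ : CardOrd (succ lam) × CardOrd (succ lam)) :
    ∃ d, ∀ β, d ≤ β → ∀ i, ∃ α ∈ A, η < α ∧ α < d ∧ c α β = ξ ∧ i < rho α β := by
  have h1 : ∀ A, Unbdd A → ∃ d, ∀ β, d ≤ β → ∃ α ∈ A, α < d ∧ c α β = ξ := fun A hA ↦ by
    by_contra! h
    choose b hb hb' using h
    obtain ⟨α, hα, s, hαs, h⟩ := hc A hA b hb ξ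
    exact hb' s α hα hαs h
  obtain ⟨P, hP, hP'⟩ := exists_split hA
  choose d hd using fun i ↦ h1 _ ((hP i).2.inter_Ioi η)
  obtain ⟨u, hu⟩ := exists_forall_lt (mk_cardOrd (lam := lam)).le d
  refine ⟨u, fun β hβ i ↦ ?_⟩
  choose α hα hαd hαc using fun j ↦ hd j β ((hu j).le.trans hβ)
  by_contra! h
  have hinj : Function.Injective α := fun j k hjk ↦ hP' j k (α j) (hα j).1 (hjk ▸ (hα k).1)
  have hsub : Set.range α ⊆ {x | x < β ∧ rho x β ≤ i} := by
    rintro _ ⟨j, rfl⟩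
    have h2 := (hαd j).trans (hu j)
    exact ⟨h2.trans_le hβ, h _ ((hP j).1 (hα j).1) (hα j).2 h2 (hαc j)⟩
  have h2 := (mk_le_mk_of_subset hsub).trans_lt (mk_rho_le_lt β i)
  rw [mk_range_eq _ hinj, mk_cardOrd] at h2
  exact h2.false

/-- The closure points of a ternary function form a club. -/
theorem isClub_closed (d : CardOrd (succ lam) → CardOrd (succ lam) → CardOrd (succ lam) →
    CardOrd (succ lam)) : IsClub {δ | ∀ x < δ, ∀ y < δ, ∀ z < δ, d x y z ≤ δ} := by
  refine ⟨fun t ht ht₀ _ δ hδ x hx y hy z hz ↦ ?_, fun a ↦ ?_⟩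
  · obtain ⟨s, hs, h⟩ := (lt_isLUB_iff hδ).1 (max_lt hx (max_lt hy hz))
    simp only [max_lt_iff] at h
    exact (ht hs x h.1 y h.2.1 z h.2.2).trans (hδ.1 hs)
  · obtain ⟨G, hG⟩ := exists_majorant (lam := lam)
      (fun γ ↦ Set.Iic γ ×ˢ Set.Iic γ ×ˢ Set.Iic γ) (fun γ ↦ by
        have h0 := aleph0_le (lam := lam)
        have h1 := mk_Iic_le γ
        rw [mk_setProd, mk_setProd]
        simpa using mul_le_of_le h0 h1 (mul_le_of_le h0 h1 h1)) fun p ↦ d p.1 p.2.1 p.2.2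
    obtain ⟨δ, h1, -, h3⟩ := exists_isGood_closed G a
    refine ⟨δ, fun x hx y hy z hz ↦ ?_, h1.le⟩
    have h4 := hG (max x (max y z)) (x, y, z) (by simp)
    exact (h4.trans (h3 _ (max_lt hx (max_lt hy hz)))).le

end Coloring

end RectangleColoring

open RectangleColoring in
theorem mainTheorem6 (lam : Cardinal.{u}) (hlam : lam.IsRegular) :
    ∃ (c : IncPair (CardOrd (succ lam)) → CardOrd (succ lam) × CardOrd (succ lam))
      (e : IncPair (CardOrd (succ lam)) → CardOrd lam),
      IsSubadditiveColoring e ∧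
      ∀ A : Set (CardOrd (succ lam)), #A = succ lam →
        ∃ D : Set (CardOrd (succ lam)), IsClub D ∧
          ∀ δ ∈ D, ∀ (β : CardOrd (succ lam)) (hβ : δ ≤ β),
            ∀ ξ₀ < δ, ∀ ξ₁ < δ, ∀ i : CardOrd lam,
              ∀ η < δ, ∃ (α : CardOrd (succ lam)) (hα : α < δ),
                η < α ∧ α ∈ A ∧
                c ⟨(α, β), hα.trans_le hβ⟩ = (ξ₀, ξ₁) ∧
                i < e ⟨(α, β), hα.trans_le hβ⟩ := by
  have : Fact lam.IsRegular := ⟨hlam⟩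
  obtain ⟨c, hc⟩ := exists_coloring (lam := lam)
  refine ⟨fun p ↦ c p.1.1 p.1.2, fun p ↦ rho p.1.1 p.1.2,
    fun x y z hxy hyz ↦ rho_subadditive z x y hxy.le hyz.le, fun A hA ↦ ?_⟩
  choose d hd using fun η ξ₀ ξ₁ ↦ exists_forall_ge_rho_gt hc hA η (ξ₀, ξ₁)
  -- Closure with d ≤ δ suffices, since the α found lies strictly below d.
  refine ⟨_, isClub_closed d, fun δ hδ β hβ ξ₀ h₀ ξ₁ h₁ i η hη ↦ ?_⟩
  have h := hδ η hη ξ₀ h₀ ξ₁ h₁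
  obtain ⟨α, hα, h2, h3, h4, h5⟩ := hd η ξ₀ ξ₁ β (h.trans hβ) i
  exact ⟨α, h3.trans_le h, h2, hα, h4, h5⟩
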